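/- Let $k\ge 1$ be an integer and let $\mu$ be a probability law on $\mathbb R$ with characteristic function $f$. For $a>1$ the Harris$(a,k)$ law is the law on $\{1,1+k,1+2k,\dots\}$ with probability generating function $$P_{a,k}(s)=\frac{s}{\{a-(a-1)s^k\}^{1/k}},\qquad |s|\le 1$$ (principal branch of the root). The law $\mu$ is called Harris$(a,k)$-ID, $a=1/p$, if for every $0<p<1$ there is a characteristic function $f_p$ of a probability law on $\mathbb R$ such that $f(t)=P_{1/p,k}(f_p(t))$ for all $t\in\mathbb R$. For $0<p<1$, the model (2) with parameter $p$ consists of real random variables $Y_{i,n}$ and $\varepsilon_{i,n}$ ($1\le i\le k$, $n\ge 0$) and events $B_n$ on one probability space such that: for each $n$ the variables $Y_{1,n},\dots,Y_{k,n}$ are i.i.d.; the innovations $\varepsilon_{i,n}$ are i.i.d. over all $i,n$; the events $B_n$ are independent, have probability $p$, and the family $(B_n)$ is independent of the family $(\varepsilon_{i,n})$; for each $n\ge1$ the vector $(\mathbf 1_{B_n},\varepsilon_{1,n},\dots,\varepsilon_{k,n})$ is independent of $(Y_{i,m})_{1\le i\le k,\,m<n}$; and for every $n\ge1$, almost surely,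 $$\sum_{i=1}^k Y_{i,n}=\begin{cases}\sum_{i=1}^k\varepsilon_{i,n} & \text{on } B_n \text{ (probability } p),\\[2pt] \sum_{i=1}^k Y_{i,n-1}+\sum_{i=1}^k\varepsilon_{i,n} & \text{off } B_n \text{ (probability } 1-p).\end{cases}\tag{2}$$ **Theorem 2.3.** The following are equivalent: 1. for every $0<p<1$ there is a model (2) with parameter $p$ such that the sequence of vectors $(Y_{1,n},\dots,Y_{k,n})_{n\ge0}$ is strictly stationary and every $Y_{i,n}$ has law $\mu$; 2. $\mu$ is Harris$(a,k)$-ID, $a=1/p$. -/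

import Mathlib

open MeasureTheory ProbabilityTheory

/-- The probability generating function of a law `N` on the non-negative integers,
as a function of a complex argument (the series converges for `‖z‖ ≤ 1`). -/
noncomputable def pgf (N : PMF ℕ) (z : ℂ) : ℂ :=
  ∑' n : ℕ, ((N n).toReal : ℂ) * z ^ n

/-- The closed form `z / (a - (a - 1) z ^ k) ^ (1 / k)`. For `a > 1` and `‖z‖ ≤ 1` the number
`a - (a - 1) z ^ k` has real part at least `1`, so the principal branch of the root is the one
that is continuous on the closed unit disk and positive on `[0, 1]`. -/
noncomputable def harrisPGF (a : ℝ) (k : ℕ) (z : ℂ) : ℂ :=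
  z / ((a : ℂ) - ((a : ℂ) - 1) * z ^ k) ^ (1 / (k : ℂ))

/-- `N` is the Harris(a,k) law: the law on `{1, 1 + k, 1 + 2k, …}` with PGF
`s / (a - (a - 1) s ^ k) ^ (1 / k)`. -/
def IsHarrisLaw (a : ℝ) (k : ℕ) (N : PMF ℕ) : Prop :=
  ∀ z : ℂ, ‖z‖ ≤ 1 → pgf N z = harrisPGF a k z

/-- The Harris(a,k) law exists. -/
theorem exists_isHarrisLaw (a : ℝ) (ha : 1 < a) (k : ℕ) (hk : 0 < k) :
    ∃ N : PMF ℕ, IsHarrisLaw a k N := by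
  set r : ℝ := 1 / (k : ℝ) with hr
  have hr0 : 0 < r := by positivity
  have ha0 : 0 < a := by linarith
  set q : ℝ := (a - 1) / a with hq
  have hq0 : 0 < q := div_pos (by linarith) ha0
  have hq1 : q < 1 := by rw [hq, div_lt_one ha0]; linarith
  set c : ℕ → ℝ := fun m => Ring.choose (r + m - 1) m with hc
  have hc0 : ∀ m, 0 ≤ c m := by
    intro m
    have h : (m.factorial : ℝ) * c m = (ascPochhammer ℕ m).smeval r := by
      rw [← Ring.factorial_nsmul_multichoose_eq_ascPochhammer, nsmul_eq_mul]
      simp only [hc, Ring.choose]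
      congr 2
      ring
    have h2 : 0 ≤ (ascPochhammer ℕ m).smeval r := by
      rw [Polynomial.ascPochhammer_smeval_eq_eval]
      exact (ascPochhammer_pos m r hr0).le
    have h3 : (0 : ℝ) < m.factorial := by positivity
    rw [← h] at h2
    exact nonneg_of_mul_nonneg_right h2 h3
  have key : ∀ x : ℂ, ‖x‖ < 1 →
      HasSum (fun m => ((c m : ℝ) : ℂ) * x ^ m) (1 / (1 - x) ^ (r : ℂ)) := by
    intro x hx
    have h := (Complex.one_div_one_sub_cpow_hasFPowerSeriesOnBall_zero (r : ℂ)).hasSum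
      (y := x) (by
        rw [Metric.mem_eball, edist_zero_right, ← ofReal_norm]
        exact ENNReal.ofReal_lt_one.2 hx)
    simp only [zero_add] at h
    convert! h using 2 with m
    simp [hc, Complex.ofReal_choose, mul_comm]
  set A : ℝ := a ^ (-r) with hA
  have hA0 : 0 < A := Real.rpow_pos_of_pos ha0 _
  set g : ℕ → ℕ := fun m => 1 + k * m with hg
  have hginj : Function.Injective g := by
    intro m n h
    simpa [hg, hk.ne'] using h
  set w : ℕ → ℝ := Function.extend g (fun m => A * (c m * q ^ m)) 0 with hw
  have hw0 : ∀ n, 0 ≤ w n := by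
    intro n
    by_cases h : ∃ m, g m = n
    · obtain ⟨m, rfl⟩ := h
      rw [hw, hginj.extend_apply]
      have := hc0 m
      positivity
    · rw [hw, Function.extend_apply' _ _ _ h]; simp
  have hsum : ∀ z : ℂ, ‖z‖ ≤ 1 →
      HasSum (fun n => ((w n : ℝ) : ℂ) * z ^ n) (harrisPGF a k z) := by
    intro z hz
    have hx : ‖(q : ℂ) * z ^ k‖ < 1 := by
      rw [norm_mul, norm_pow, Complex.norm_real, Real.norm_of_nonneg hq0.le]
      calc q * ‖z‖ ^ k ≤ q * 1 := by
            gcongr; exact pow_le_one₀ (norm_nonneg _) hz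
        _ < 1 := by linarith
    have h1 := (key _ hx).mul_left ((A : ℂ) * z)
    have h2 : (A : ℂ) * z * (1 / (1 - (q : ℂ) * z ^ k) ^ (r : ℂ)) = harrisPGF a k z := by
      have e1 : (a : ℂ) - ((a : ℂ) - 1) * z ^ k = (a : ℂ) * (1 - (q : ℂ) * z ^ k) := by
        have : (a : ℂ) ≠ 0 := by exact_mod_cast ha0.ne'
        rw [hq]; push_cast; field_simp
      have e2 : (1 / (k : ℂ)) = (r : ℂ) := by rw [hr]; push_cast; rfl
      have hne : 1 - (q : ℂ) * z ^ k ≠ 0 := by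
        intro h0
        rw [← sub_eq_zero.1 h0] at hx
        simp at hx
      have hac : (a : ℂ) ≠ 0 := by exact_mod_cast ha0.ne'
      have e3 : ((a : ℂ) * (1 - (q : ℂ) * z ^ k)) ^ (r : ℂ) =
          (a : ℂ) ^ (r : ℂ) * (1 - (q : ℂ) * z ^ k) ^ (r : ℂ) := by
        rw [Complex.cpow_def_of_ne_zero (mul_ne_zero hac hne), Complex.cpow_def_of_ne_zero hac,
          Complex.cpow_def_of_ne_zero hne, Complex.log_ofReal_mul ha0 hne,
          Complex.ofReal_log ha0.le, add_mul, Complex.exp_add]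
      rw [harrisPGF, e1, e2, e3, hA, Complex.ofReal_cpow ha0.le]
      push_cast
      rw [Complex.cpow_neg]
      field_simp
    rw [h2] at h1
    rw [← hginj.hasSum_iff]
    · convert! h1 using 2 with m
      simp only [Function.comp_apply, hw, hginj.extend_apply]
      simp only [hg]
      push_cast
      ring
    · intro n hn
      have : ¬ ∃ m, g m = n := fun ⟨m, h⟩ => hn ⟨m, h⟩
      rw [hw, Function.extend_apply' _ _ _ this]; simp
  have hone : HasSum w 1 := by
    have h := hsum 1 (by simp)
    have e : harrisPGF a k 1 = ((1 : ℝ) : ℂ) := by simp [harrisPGF]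
    rw [e] at h
    simp only [one_pow, mul_one] at h
    exact_mod_cast h
  refine ⟨⟨fun n => ENNReal.ofReal (w n), ?_⟩, ?_⟩
  · have h := ENNReal.ofReal_tsum_of_nonneg hw0 hone.summable
    rw [hone.tsum_eq, ENNReal.ofReal_one] at h
    rw [h]
    exact ENNReal.summable.hasSum
  · intro z hz
    rw [← (hsum z hz).tsum_eq]
    refine tsum_congr fun n => ?_
    congr 2
    exact ENNReal.toReal_ofReal (hw0 n)

/-- `μ` is infinitely divisible with respect to the Harris(a,k) laws, `a = 1 / p`, `0 < p < 1`:
for each `p` the characteristic function of `μ` is `P (f_p)`, where `P` is the PGF of the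
Harris(1/p,k) law and `f_p` is the characteristic function of a probability law on `ℝ`. -/
def IsHarrisID (k : ℕ) (μ : Measure ℝ) : Prop :=
  ∀ p : ℝ, 0 < p → p < 1 →
    ∃ N : PMF ℕ, IsHarrisLaw (1 / p) k N ∧
      ∃ ν : Measure ℝ, IsProbabilityMeasure ν ∧
        ∀ t : ℝ, charFun μ t = pgf N (charFun ν t)

/-- The generalized first order autoregressive scheme with parameter `p`, on the probability
space `(Ω, P)`. `Y n i` is the `i`-th component at time `n` (`n = 0` being the initial state),
`e n i` the `i`-th innovation at time `n`, and `B n = true` the event, of probability `p`, that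
the previous state is excluded at time `n`. -/
structure IsGenAR1 (k : ℕ) (p : ℝ) {Ω : Type} [MeasurableSpace Ω] (P : Measure Ω)
    (Y e : ℕ → Fin k → Ω → ℝ) (B : ℕ → Ω → Bool) : Prop where
  measurable_Y : ∀ n i, Measurable (Y n i)
  measurable_e : ∀ n i, Measurable (e n i)
  measurable_B : ∀ n, Measurable (B n)
  /-- at each time the `k` components are independent -/
  indep_Y : ∀ n, iIndepFun (Y n) P
  /-- at each time the `k` components are identically distributed -/
  ident_Y : ∀ n i j, IdentDistrib (Y n i) (Y n j) P P
  /-- the innovations are independent -/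
  indep_e : iIndepFun (fun q : ℕ × Fin k => e q.1 q.2) P
  /-- the innovations are identically distributed -/
  ident_e : ∀ n m i j, IdentDistrib (e n i) (e m j) P P
  /-- the selectors are independent Bernoulli variables -/
  indep_B : iIndepFun B P
  prob_B : ∀ n, P {ω | B n ω = true} = ENNReal.ofReal p
  /-- the selectors are independent of the innovations -/
  indep_B_e : IndepFun (fun ω n => B n ω) (fun ω (q : ℕ × Fin k) => e q.1 q.2 ω) P
  /-- selector and innovations of time `n + 1` are independent of the states up to time `n` -/
  indep_past : ∀ n, IndepFun (fun ω (q : Fin (n + 1) × Fin k) => Y q.1 q.2 ω)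
    (fun ω => (B (n + 1) ω, fun i => e (n + 1) i ω)) P
  /-- the autoregressive equation -/
  equation : ∀ n, ∀ᵐ ω ∂P, ∑ i, Y (n + 1) i ω =
    if B (n + 1) ω = true then ∑ i, e (n + 1) i ω
    else ∑ i, Y n i ω + ∑ i, e (n + 1) i ω

/-- Strict stationarity of the `k`-component sequence `Y`. -/
def IsStationarySeq {k : ℕ} {Ω : Type} [MeasurableSpace Ω] (P : Measure Ω)
    (Y : ℕ → Fin k → Ω → ℝ) : Prop :=
  ∀ m : ℕ, IdentDistrib (fun ω n i => Y (n + m) i ω) (fun ω n i => Y n i ω) P P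

/-- There is a stationary version of the generalized autoregressive scheme with parameter `p`
in which every component `Y n i` has law `μ`. -/
def HasStationaryGenAR1 (k : ℕ) (p : ℝ) (μ : Measure ℝ) : Prop :=
  ∃ (Ω : Type) (_ : MeasurableSpace Ω) (P : Measure Ω) (_ : IsProbabilityMeasure P)
    (Y e : ℕ → Fin k → Ω → ℝ) (B : ℕ → Ω → Bool),
    IsGenAR1 k p P Y e B ∧ IsStationarySeq P Y ∧ ∀ n i, HasLaw (Y n i) μ P

/-! Let `f` and `ψ` be the characteristic functions of one state and of one innovation. Passing to
sums of components turns (2) into f^k = ψ^k (p + (1 - p) f^k) (`charFun_map_ite_add`). Solved for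
f^k, this is the k-th power of f = P(ψ), with P the Harris(1/p,k) generating function
(`harrisPGF_pow_eq_iff`). Both directions rest on this equation.

From models to Harris-ID, the k-th power has to be undone. Since f and P(ψ) are continuous and agree
at 0, it suffices that they have no zeros (`eq_of_pow_eq_of_continuous`). Here all p are used
together: if f(2t) = 0 but f(t) ≠ 0, then ψ^k vanishes at 2t for every p, while at t it tends to 1
as p → 0. The doubling inequality for characteristic functions forbids this
(`ne_zero_of_forall_ar_equation`).

Conversely, the equation says only that one step preserves the law of the sum of k independent
variables of law μ. The components are then redrawn from their conditional law given that sum, using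
an independent auxiliary variable (`exists_measurable_regenerate`). This makes the k-fold product of
μ invariant and (2) true almost surely, and the time-homogeneous chain so obtained is stationary. -/

/-! ### Absence of zeros -/

/-- The real part of a characteristic function satisfies `1 - Re φ(2t) ≤ 4 (1 - Re φ(t))`. -/
theorem one_sub_re_charFun_two_mul_le (ρ : Measure ℝ) [IsProbabilityMeasure ρ] (t : ℝ) :
    1 - (charFun ρ (2 * t)).re ≤ 4 * (1 - (charFun ρ t).re) := by
  have hcos : ∀ s : ℝ, Integrable (fun x : ℝ => Real.cos (s * x)) ρ := fun s =>
    Integrable.of_bound (by fun_prop) 1 (ae_of_all _ fun x => by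
      simpa using Real.abs_cos_le_one _)
  have hre : ∀ s : ℝ, (charFun ρ s).re = ∫ x, Real.cos (s * x) ∂ρ := by
    intro s
    have hi : Integrable (fun x : ℝ => Complex.exp (s * x * Complex.I)) ρ :=
      Integrable.of_bound (by fun_prop) 1 (ae_of_all _ fun x => by
        rw [← Complex.ofReal_mul, Complex.norm_exp_ofReal_mul_I])
    rw [charFun_apply_real, ← RCLike.re_eq_complex_re, ← integral_re hi]
    refine integral_congr_ae (ae_of_all _ fun x => ?_)
    simp only [RCLike.re_eq_complex_re]
    rw [← Complex.ofReal_mul, Complex.exp_ofReal_mul_I_re]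
  rw [hre, hre]
  have h1 : ∀ s : ℝ, 1 - ∫ x, Real.cos (s * x) ∂ρ = ∫ x, (1 - Real.cos (s * x)) ∂ρ := by
    intro s
    rw [integral_sub (integrable_const _) (hcos s)]
    simp
  rw [h1, h1, ← integral_const_mul]
  refine integral_mono ((integrable_const _).sub (hcos _))
    (((integrable_const _).sub (hcos _)).const_mul _) fun x => ?_
  have h2 : Real.cos (2 * t * x) = 2 * Real.cos (t * x) ^ 2 - 1 := by
    rw [← Real.cos_two_mul]; ring_nf
  simp only [h2]
  -- With c = cos(tx), the right side minus the left is 2(1 - c)^2.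
  nlinarith [sq_nonneg (1 - Real.cos (t * x))]

/-- A function that does not vanish near `0`, and whose non-vanishing at `t` implies that at
`2 * t`, has no zeros. -/
theorem forall_ne_zero_of_double {f : ℝ → ℂ} (hf : ContinuousAt f 0) (h0 : f 0 ≠ 0)
    (h2 : ∀ t, f t ≠ 0 → f (2 * t) ≠ 0) (t : ℝ) : f t ≠ 0 := by
  have hlim : Filter.Tendsto (fun n : ℕ => (1 / 2 : ℝ) ^ n * t) Filter.atTop (nhds 0) := by
    simpa using (tendsto_pow_atTop_nhds_zero_of_lt_one (r := (1 / 2 : ℝ)) (by norm_num)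
      (by norm_num)).mul_const t
  obtain ⟨n, hn⟩ := (hlim.eventually (hf.eventually_ne h0)).exists
  have : ∀ m : ℕ, f (2 ^ m * ((1 / 2 : ℝ) ^ n * t)) ≠ 0 := by
    intro m
    induction m with
    | zero => simpa using hn
    | succ m ih =>
      have := h2 _ ih
      rwa [← mul_assoc, ← pow_succ'] at this
  have h := this n
  rwa [← mul_assoc, ← mul_pow, show (2 : ℝ) * (1 / 2) = 1 by norm_num, one_pow, one_mul] at h

/-- If for every `0 < p < 1` the equation `g = ψ (p + (1 - p) g)` has a solution `ψ` that is the
characteristic function of a probability law, then `g` has no zeros. -/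
theorem ne_zero_of_forall_ar_equation {g : ℝ → ℂ} (hg : Continuous g) (hg0 : g 0 = 1)
    (h : ∀ p : ℝ, 0 < p → p < 1 → ∃ ρ : Measure ℝ, IsProbabilityMeasure ρ ∧
      ∀ t, g t = charFun ρ t * (p + (1 - p) * g t)) (t : ℝ) : g t ≠ 0 := by
  refine forall_ne_zero_of_double hg.continuousAt (by simp [hg0]) (fun t ht h2 => ?_) t
  -- Any sequence in (0,1) tending to 0 would do; the shift by 2 keeps the term at `n = 0` below 1.
  set p : ℕ → ℝ := fun n => 1 / ((n : ℝ) + 2) with hp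
  have hp0 : ∀ n, 0 < p n := fun n => by positivity
  have hp1 : ∀ n, p n < 1 := fun n => by
    rw [hp, div_lt_one (by positivity)]
    have : (0 : ℝ) ≤ n := n.cast_nonneg
    linarith
  have hplim : Filter.Tendsto p Filter.atTop (nhds 0) := by
    have := (tendsto_one_div_add_atTop_nhds_zero_nat (𝕜 := ℝ)).comp (Filter.tendsto_add_atTop_nat 1)
    refine this.congr fun n => ?_
    simp only [hp, Function.comp_apply]
    push_cast
    ring
  choose ρ hρ hρe using fun n => h (p n) (hp0 n) (hp1 n)
  -- Where `g` vanishes, the second factor of the equation is just `p n`, which is nonzero.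
  have hz : ∀ n, charFun (ρ n) (2 * t) = 0 := by
    intro n
    have := hρe n (2 * t)
    rw [h2] at this
    have hpc : ((p n : ℝ) : ℂ) ≠ 0 := by exact_mod_cast (hp0 n).ne'
    simpa [hpc] using this
  have hden : Filter.Tendsto (fun n => (p n : ℂ) + (1 - p n) * g t) Filter.atTop (nhds (g t)) := by
    have hpc : Filter.Tendsto (fun n => (p n : ℂ)) Filter.atTop (nhds 0) := by
      exact_mod_cast (Complex.continuous_ofReal.tendsto 0).comp hplim
    simpa using hpc.add ((hpc.const_sub 1).mul_const (g t))
  have hlim : Filter.Tendsto (fun n => charFun (ρ n) t) Filter.atTop (nhds 1) := by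
    have h1 := (tendsto_const_nhds (x := g t)).div hden ht
    rw [div_self ht] at h1
    refine h1.congr' ?_
    filter_upwards [hden.eventually_ne ht] with n hn
    exact (eq_div_of_mul_eq hn (hρe n t).symm).symm
  have hre : Filter.Tendsto (fun n => 4 * (1 - (charFun (ρ n) t).re)) Filter.atTop (nhds 0) := by
    have := (Complex.continuous_re.tendsto 1).comp hlim
    simpa using (this.const_sub 1).const_mul 4
  -- The doubling inequality bounds 1 by a sequence that tends to 0.
  have : (1 : ℝ) ≤ 0 := by
    refine ge_of_tendsto' hre fun n => ?_
    have := hρ n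
    have h3 := one_sub_re_charFun_two_mul_le (ρ n) t
    rw [hz n] at h3
    simpa using h3
  linarith

/-! ### The Harris generating function on the closed disk and its k-th power -/

/-- Follows from Re z^k ≤ 1. It keeps the base of the root in the right half-plane, hence nonzero
and away from the cut of the principal branch. -/
theorem one_le_re_harris_den {a : ℝ} (ha : 1 < a) (k : ℕ) {z : ℂ} (hz : ‖z‖ ≤ 1) :
    1 ≤ ((a : ℂ) - ((a : ℂ) - 1) * z ^ k).re := by
  have h1 : (z ^ k).re ≤ 1 :=
    (Complex.re_le_norm _).trans (by rw [norm_pow]; exact pow_le_one₀ (norm_nonneg _) hz)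
  have h2 : ((a : ℂ) - ((a : ℂ) - 1) * z ^ k).re = a - (a - 1) * (z ^ k).re := by
    simp [Complex.sub_re, Complex.mul_re]
  rw [h2]
  nlinarith

theorem harris_den_ne_zero {a : ℝ} (ha : 1 < a) (k : ℕ) {z : ℂ} (hz : ‖z‖ ≤ 1) :
    (a : ℂ) - ((a : ℂ) - 1) * z ^ k ≠ 0 := by
  intro h
  have := one_le_re_harris_den ha k hz
  rw [h] at this
  simp at this
  linarith

/-- The `k`-th power of the Harris generating function. -/
theorem harrisPGF_pow {a : ℝ} (k : ℕ) (hk : 0 < k) (z : ℂ) :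
    harrisPGF a k z ^ k = z ^ k / ((a : ℂ) - ((a : ℂ) - 1) * z ^ k) := by
  rw [harrisPGF, div_pow, one_div, Complex.cpow_nat_inv_pow _ hk.ne']

/-- The k-th power removes the root, and what remains is an equation linear in `w` with a
nonvanishing denominator, so it can be cleared both ways. -/
theorem harrisPGF_pow_eq_iff {p : ℝ} (hp0 : 0 < p) (hp1 : p < 1) (k : ℕ) (hk : 0 < k)
    {z : ℂ} (hz : ‖z‖ ≤ 1) (w : ℂ) :
    w = harrisPGF (1 / p) k z ^ k ↔ w = z ^ k * (p + (1 - p) * w) := by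
  have ha : 1 < 1 / p := by rwa [lt_div_iff₀ hp0, one_mul]
  have hpc : (p : ℂ) ≠ 0 := by exact_mod_cast hp0.ne'
  rw [harrisPGF_pow k hk, eq_div_iff (harris_den_ne_zero ha k hz)]
  have e : ((1 / p : ℝ) : ℂ) - (((1 / p : ℝ) : ℂ) - 1) * z ^ k =
      (1 - (1 - p) * z ^ k) / p := by
    push_cast; field_simp
  rw [e, mul_div_assoc', div_eq_iff hpc]
  constructor <;> intro h <;> linear_combination h

theorem continuous_harrisPGF_comp {a : ℝ} (ha : 1 < a) (k : ℕ) {ψ : ℝ → ℂ}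
    (hψ : Continuous ψ) (hψ1 : ∀ t, ‖ψ t‖ ≤ 1) : Continuous fun t => harrisPGF a k (ψ t) := by
  unfold harrisPGF
  refine hψ.div ?_ fun t => ?_
  · refine Continuous.cpow (by fun_prop) continuous_const fun t => ?_
    exact Or.inl (lt_of_lt_of_le one_pos (one_le_re_harris_den ha k (hψ1 t)))
  · rw [Ne, Complex.cpow_eq_zero_iff]
    exact fun h => harris_den_ne_zero ha k (hψ1 t) h.1

/-- Two continuous non-vanishing functions on `ℝ` with the same `k`-th power which agree at `0`
are equal. -/
theorem eq_of_pow_eq_of_continuous {f g : ℝ → ℂ} {k : ℕ} (hk : 0 < k) (hf : Continuous f)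
    (hg : Continuous g) (hg0 : ∀ t, g t ≠ 0) (h0 : f 0 = g 0) (h : ∀ t, f t ^ k = g t ^ k) :
    f = g := by
  have hr : Continuous fun t => f t / g t := hf.div hg hg0
  -- The quotient takes values in the finite, hence discrete, set of k-th roots of unity, so it is
  -- constant on the connected line.
  have hfin : {z : ℂ | z ^ k = 1}.Finite := by
    refine (Polynomial.nthRootsFinset k (1 : ℂ)).finite_toSet.subset fun z hz => ?_
    simpa [Polynomial.mem_nthRootsFinset hk] using hz
  funext t
  have hm : Set.MapsTo (fun t => f t / g t) Set.univ {z : ℂ | z ^ k = 1} := fun s _ => by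
    simp [div_pow, h s, hg0 s]
  have key := isPreconnected_univ.constant_of_mapsTo hfin.isDiscrete hr.continuousOn hm
    (Set.mem_univ t) (Set.mem_univ 0)
  simp only [h0, div_self (hg0 0)] at key
  exact (div_eq_one_iff_eq (hg0 t)).1 key

/-! ### Characteristic functions of sums and of one autoregressive step -/

/-- The characteristic function of the sum of `k` independent variables with law `μ`. -/
theorem charFun_map_sum_pi_const {k : ℕ} (μ : Measure ℝ) [IsProbabilityMeasure μ] (t : ℝ) :
    charFun ((Measure.pi fun _ : Fin k => μ).map fun y => ∑ i, y i) t = charFun μ t ^ k := by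
  rw [charFun_map_sum_pi_eq_prod]
  simp

theorem charFun_map_sum_eq_pow {Ω : Type*} [MeasurableSpace Ω] {P : Measure Ω} {k : ℕ}
    {X : Fin k → Ω → ℝ} (hX : ∀ i, Measurable (X i)) (hind : iIndepFun X P) {μ : Measure ℝ}
    (hμ : ∀ i, P.map (X i) = μ) (t : ℝ) :
    charFun (P.map fun ω => ∑ i, X i ω) t = charFun μ t ^ k := by
  rw [hind.charFun_map_fun_sum_eq_prod fun i => (hX i).aemeasurable]
  simp [hμ]

/-- The characteristic function after one step of the autoregressive scheme. -/
theorem charFun_map_ite_add {Ω : Type*} [MeasurableSpace Ω] {P : Measure Ω}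
    [IsProbabilityMeasure P] {X Z : Ω → ℝ} {B : Ω → Bool} (hX : Measurable X) (hZ : Measurable Z)
    (hB : Measurable B) (hXBZ : IndepFun X (fun ω => (B ω, Z ω)) P) (hBZ : IndepFun B Z P)
    {p : ℝ} (hp0 : 0 ≤ p) (hp : P {ω | B ω = true} = ENNReal.ofReal p) (t : ℝ) :
    charFun (P.map fun ω => if B ω = true then Z ω else X ω + Z ω) t =
      charFun (P.map Z) t * (p + (1 - p) * charFun (P.map X) t) := by
  have hset : MeasurableSet {ω | B ω = true} := hB (measurableSet_singleton true)
  have hW : Measurable fun ω => if B ω = true then Z ω else X ω + Z ω :=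
    Measurable.ite hset hZ (hX.add hZ)
  set E : ℝ → ℂ := fun x => Complex.exp (t * x * Complex.I) with hE
  have hEm : Measurable E := by fun_prop
  have hEn : ∀ x, ‖E x‖ = 1 := fun x => by
    rw [hE]; dsimp only; rw [← Complex.ofReal_mul, Complex.norm_exp_ofReal_mul_I]
  have hch : ∀ V : Ω → ℝ, Measurable V → charFun (P.map V) t = ∫ ω, E (V ω) ∂P := by
    intro V hV
    rw [charFun_apply_real, integral_map hV.aemeasurable (by fun_prop)]
  set b : Bool → ℂ := fun x => if x then 1 else 0 with hb
  have hbm : Measurable b := measurable_of_countable _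
  have hbn : ∀ x, ‖b x‖ ≤ 1 := fun x => by cases x <;> simp [hb]
  have hbn' : ∀ x, ‖1 - b x‖ ≤ 1 := fun x => by cases x <;> simp [hb]
  have hbi : ∫ ω, b (B ω) ∂P = p := by
    have : (fun ω => b (B ω)) = {ω | B ω = true}.indicator fun _ => (1 : ℂ) := by
      funext ω
      simp [hb, Set.indicator_apply]
    rw [this, integral_indicator_const _ hset, measureReal_def, hp, ENNReal.toReal_ofReal hp0]
    simp
  have hbint : Integrable (fun ω => b (B ω)) P :=
    Integrable.of_bound (hbm.comp hB).aestronglyMeasurable 1 (ae_of_all _ fun ω => hbn _)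
  have h1 : Integrable (fun ω => b (B ω) * E (Z ω)) P :=
    Integrable.of_bound ((hbm.comp hB).mul (hEm.comp hZ)).aestronglyMeasurable 1
      (ae_of_all _ fun ω => by rw [norm_mul, hEn, mul_one]; exact hbn _)
  have h2 : Integrable (fun ω => E (X ω) * ((1 - b (B ω)) * E (Z ω))) P :=
    Integrable.of_bound ((hEm.comp hX).mul
      ((measurable_const.sub (hbm.comp hB)).mul (hEm.comp hZ))).aestronglyMeasurable 1
      (ae_of_all _ fun ω => by rw [norm_mul, norm_mul, hEn, hEn, mul_one, one_mul]; exact hbn' _)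
  -- `b` is the indicator of the selector, so each term becomes a product of functions of
  -- independent variables.
  have hdecomp : ∀ ω, E (if B ω = true then Z ω else X ω + Z ω) =
      b (B ω) * E (Z ω) + E (X ω) * ((1 - b (B ω)) * E (Z ω)) := by
    intro ω
    cases hω : B ω
    · simp [hb, hE, ← Complex.exp_add]; ring_nf
    · simp [hb]
  have i1 : ∫ ω, b (B ω) * E (Z ω) ∂P = p * ∫ ω, E (Z ω) ∂P := by
    refine ((hBZ.comp hbm hEm).integral_fun_mul_eq_mul_integral
      (hbm.comp hB).aestronglyMeasurable (hEm.comp hZ).aestronglyMeasurable).trans ?_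
    simp only [Function.comp_apply, hbi]
  have i2 : ∫ ω, (1 - b (B ω)) * E (Z ω) ∂P = (1 - p) * ∫ ω, E (Z ω) ∂P := by
    have hm : Measurable fun x : Bool => 1 - b x := measurable_of_countable _
    refine ((hBZ.comp hm hEm).integral_fun_mul_eq_mul_integral
      (hm.comp hB).aestronglyMeasurable (hEm.comp hZ).aestronglyMeasurable).trans ?_
    simp only [Function.comp_apply]
    rw [integral_sub (integrable_const _) hbint, hbi]
    simp
  have i3 : ∫ ω, E (X ω) * ((1 - b (B ω)) * E (Z ω)) ∂P =
      (∫ ω, E (X ω) ∂P) * ∫ ω, (1 - b (B ω)) * E (Z ω) ∂P := by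
    have hm : Measurable fun x : Bool × ℝ => (1 - b x.1) * E x.2 :=
      (measurable_const.sub (hbm.comp measurable_fst)).mul (hEm.comp measurable_snd)
    exact (hXBZ.comp hEm hm).integral_fun_mul_eq_mul_integral
      (hEm.comp hX).aestronglyMeasurable (hm.comp (hB.prodMk hZ)).aestronglyMeasurable
  rw [hch _ hW, hch _ hZ, hch _ hX]
  simp_rw [hdecomp]
  rw [integral_add h1 h2, i3, i2, i1]
  ring

/-! ### From stationary models to Harris-ID -/

/-- In a stationary scheme the characteristic functions `f` of the states and `ψ` of the
innovations satisfy `f ^ k = ψ ^ k (p + (1 - p) f ^ k)`. -/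
theorem HasStationaryGenAR1.exists_charFun_pow_eq {k : ℕ} (hk : 0 < k) {p : ℝ} (hp : 0 ≤ p)
    {μ : Measure ℝ} (h : HasStationaryGenAR1 k p μ) :
    ∃ ν : Measure ℝ, IsProbabilityMeasure ν ∧
      ∀ t, charFun μ t ^ k = charFun ν t ^ k * (p + (1 - p) * charFun μ t ^ k) := by
  obtain ⟨Ω, _, P, hP, Y, e, B, hM, -, hlaw⟩ := h
  refine ⟨P.map (e 1 ⟨0, hk⟩), Measure.isProbabilityMeasure_map (hM.measurable_e _ _).aemeasurable,
    fun t => ?_⟩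
  have hmY : ∀ n, Measurable fun ω => ∑ i, Y n i ω := fun n =>
    Finset.measurable_sum _ fun i _ => hM.measurable_Y n i
  have hme : Measurable fun ω => ∑ i, e 1 i ω :=
    Finset.measurable_sum _ fun i _ => hM.measurable_e 1 i
  have hf : ∀ n, charFun (P.map fun ω => ∑ i, Y n i ω) t = charFun μ t ^ k := fun n =>
    charFun_map_sum_eq_pow (hM.measurable_Y n) (hM.indep_Y n) (fun i => (hlaw n i).map_eq) t
  have hψ : charFun (P.map fun ω => ∑ i, e 1 i ω) t = charFun (P.map (e 1 ⟨0, hk⟩)) t ^ k :=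
    charFun_map_sum_eq_pow (hM.measurable_e 1)
      (hM.indep_e.precomp (g := fun i : Fin k => ((1 : ℕ), i))
        (fun i j hij => (Prod.mk.inj hij).2))
      (fun i => (hM.ident_e 1 1 i ⟨0, hk⟩).map_eq) t
  have hXBZ : IndepFun (fun ω => ∑ i, Y 0 i ω) (fun ω => (B 1 ω, ∑ i, e 1 i ω)) P :=
    (hM.indep_past 0).comp (φ := fun y : Fin 1 × Fin k → ℝ => ∑ i, y (0, i))
      (ψ := fun z : Bool × (Fin k → ℝ) => (z.1, ∑ i, z.2 i)) (by fun_prop) (by fun_prop)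
  have hBZ : IndepFun (B 1) (fun ω => ∑ i, e 1 i ω) P :=
    hM.indep_B_e.comp (φ := fun b : ℕ → Bool => b 1)
      (ψ := fun x : ℕ × Fin k → ℝ => ∑ i, x (1, i)) (by fun_prop) (by fun_prop)
  have key := charFun_map_ite_add (hmY 0) hme (hM.measurable_B 1) hXBZ hBZ hp (hM.prob_B 1) t
  rw [hf 0, hψ] at key
  rw [← key, ← hf 1]
  exact congrArg (charFun · t) (Measure.map_congr (hM.equation 0))

theorem isHarrisID_of_hasStationaryGenAR1 {k : ℕ} (hk : 0 < k) {μ : Measure ℝ}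
    [IsProbabilityMeasure μ] (h : ∀ p : ℝ, 0 < p → p < 1 → HasStationaryGenAR1 k p μ) :
    IsHarrisID k μ := by
  have hne : ∀ t, charFun μ t ^ k ≠ 0 := by
    refine ne_zero_of_forall_ar_equation (continuous_charFun.pow k) (by simp) fun p hp0 hp1 => ?_
    obtain ⟨ν, hν, he⟩ := (h p hp0 hp1).exists_charFun_pow_eq hk hp0.le
    -- The k-fold convolution of `ν` makes the k-th power itself a characteristic function.
    refine ⟨(Measure.pi fun _ : Fin k => ν).map fun y => ∑ i, y i,
      Measure.isProbabilityMeasure_map (by fun_prop), fun t => ?_⟩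
    rw [charFun_map_sum_pi_const]
    exact he t
  intro p hp0 hp1
  obtain ⟨ν, hν, he⟩ := (h p hp0 hp1).exists_charFun_pow_eq hk hp0.le
  have ha : 1 < 1 / p := by rwa [lt_div_iff₀ hp0, one_mul]
  obtain ⟨N, hN⟩ := exists_isHarrisLaw (1 / p) ha k hk
  refine ⟨N, hN, ν, hν, fun t => ?_⟩
  rw [hN _ (norm_charFun_le_one t)]
  have hpow : ∀ t, charFun μ t ^ k = harrisPGF (1 / p) k (charFun ν t) ^ k := fun t =>
    (harrisPGF_pow_eq_iff hp0 hp1 k hk (norm_charFun_le_one t) _).2 (he t)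
  refine congrFun (eq_of_pow_eq_of_continuous hk continuous_charFun
    (continuous_harrisPGF_comp ha k continuous_charFun norm_charFun_le_one) (fun t h0 => ?_) ?_
    hpow) t
  -- A zero of the composite would be a zero of the k-th power of `charFun μ`.
  · exact hne t (by rw [hpow t, h0, zero_pow hk.ne'])
  · simp [harrisPGF]

/-! ### Construction of the chain from independent coordinates -/

/-- The index type of the randomness used at one time: initial states, innovations,
selector (`true`) and auxiliary uniform variable (`false`). -/
abbrev ARIndex (k : ℕ) : Type := Fin k ⊕ (Fin k ⊕ Bool)

/-- Functions of disjoint subfamilies of an independent family are independent. -/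
theorem ProbabilityTheory.iIndepFun.indepFun_of_measurable_iSup_comap {Ω ι β γ : Type*}
    {κ : ι → Type*} [MeasurableSpace Ω] {P : Measure Ω} [∀ i, MeasurableSpace (κ i)]
    [mβ : MeasurableSpace β] [mγ : MeasurableSpace γ] {X : ∀ i, Ω → κ i} (hX : iIndepFun X P)
    (hm : ∀ i, Measurable (X i)) {S T : Set ι} (hST : Disjoint S T) {f : Ω → β} {g : Ω → γ}
    (hf : Measurable[⨆ i ∈ S, MeasurableSpace.comap (X i) inferInstance] f)
    (hg : Measurable[⨆ i ∈ T, MeasurableSpace.comap (X i) inferInstance] g) :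
    IndepFun f g P := by
  have h := indep_iSup_of_disjoint (fun i => (hm i).comap_le) hX.iIndep hST
  rw [IndepFun_iff_Indep]
  exact indep_of_indep_of_le_left (indep_of_indep_of_le_right h hg.comap_le) hf.comap_le

/-- A random element `y` with law `π` can be regenerated from `g y` and an independent real
variable. -/
theorem exists_measurable_regenerate {E : Type*} [MeasurableSpace E] [StandardBorelSpace E]
    [Nonempty E] (π : Measure E) [IsProbabilityMeasure π] {g : E → ℝ} (hg : Measurable g) :
    ∃ (υ : Measure ℝ) (K : ℝ × ℝ → E), IsProbabilityMeasure υ ∧ Measurable K ∧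
      ((π.map g).prod υ).map (fun q => (q.1, K q)) = π.map fun y => (g y, y) := by
  have : IsProbabilityMeasure (π.map g) := Measure.isProbabilityMeasure_map hg.aemeasurable
  -- The conditional law given `g` is the image of Lebesgue measure on [0,1] under a jointly
  -- measurable map; `projIcc` then extends that map to a real second argument.
  obtain ⟨f, hf, hfκ⟩ := Kernel.exists_measurable_map_eq_unitInterval (condDistrib id g π)
  have hpr : Measurable (Set.projIcc (0 : ℝ) 1 zero_le_one) := continuous_projIcc.measurable
  have hK : Measurable fun q : ℝ × ℝ => f q.1 (Set.projIcc 0 1 zero_le_one q.2) :=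
    hf.comp (measurable_fst.prodMk (hpr.comp measurable_snd))
  refine ⟨(volume : Measure unitInterval).map Subtype.val, _,
    Measure.isProbabilityMeasure_map (by fun_prop), hK, ?_⟩
  have h : Measure.compProd (π.map g) (condDistrib id g π) = π.map fun y => (g y, y) :=
    compProd_map_condDistrib aemeasurable_id
  rw [← h]
  ext s hs
  rw [Measure.map_apply (by fun_prop) hs, Measure.prod_apply (hs.preimage (by fun_prop)),
    Measure.compProd_apply hs]
  refine lintegral_congr fun a => ?_
  have hfa : Measurable (f a) := hf.comp measurable_prodMk_left
  rw [← hfκ a, Measure.map_apply hfa (hs.preimage measurable_prodMk_left),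
    Measure.map_apply measurable_subtype_coe
      ((hs.preimage (measurable_fst.prodMk hK)).preimage measurable_prodMk_left)]
  congr 1
  ext u
  simp

section Construction

variable {k : ℕ}

/-- The selector as a function of the corresponding coordinate. -/
noncomputable def isOne (x : ℝ) : Bool := decide (x = 1)

theorem measurable_isOne : Measurable isOne := by
  refine measurable_to_bool ?_
  convert measurableSet_singleton (1 : ℝ)
  ext x
  simp [isOne]

/-- The sum of the states after one step from `y`, with selector `b` and innovations `e`. -/
noncomputable def arSum (y : Fin k → ℝ) (b : ℝ) (e : Fin k → ℝ) : ℝ :=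
  if isOne b = true then ∑ i, e i else ∑ i, y i + ∑ i, e i

/-- One step of the chain: the components are regenerated from their sum. -/
noncomputable def arStep (K : ℝ × ℝ → Fin k → ℝ) (y : Fin k → ℝ) (x : ARIndex k → ℝ) :
    Fin k → ℝ :=
  K (arSum y (x (.inr (.inr true))) fun i => x (.inr (.inl i)), x (.inr (.inr false)))

/-- The chain started at `y` and driven by the randomness `ξ`. -/
noncomputable def arChain (K : ℝ × ℝ → Fin k → ℝ) (y : Fin k → ℝ) (ξ : ℕ × ARIndex k → ℝ) :
    ℕ → Fin k → ℝ
  | 0 => y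
  | n + 1 => arStep K (arChain K y ξ n) fun j => ξ (n, j)

theorem measurable_arSum :
    Measurable fun q : (Fin k → ℝ) × ℝ × (Fin k → ℝ) => arSum q.1 q.2.1 q.2.2 :=
  Measurable.ite
    ((measurable_isOne.comp measurable_snd.fst) (measurableSet_singleton true))
    (by fun_prop) (by fun_prop)

theorem measurable_arStep {K : ℝ × ℝ → Fin k → ℝ} (hK : Measurable K) :
    Measurable fun q : (Fin k → ℝ) × (ARIndex k → ℝ) => arStep K q.1 q.2 :=
  hK.comp ((measurable_arSum.comp
    (f := fun q : (Fin k → ℝ) × (ARIndex k → ℝ) =>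
      (q.1, q.2 (.inr (.inr true)), fun i => q.2 (.inr (.inl i)))) (by fun_prop)).prodMk
    (by fun_prop))

theorem measurable_arChain {K : ℝ × ℝ → Fin k → ℝ} (hK : Measurable K) (n : ℕ) :
    Measurable fun q : (Fin k → ℝ) × (ℕ × ARIndex k → ℝ) => arChain K q.1 q.2 n := by
  induction n with
  | zero => exact measurable_fst
  | succ n ih =>
    exact (measurable_arStep hK).comp (ih.prodMk (by fun_prop))

/-- The states as functions of the whole randomness. -/
noncomputable def arState (K : ℝ × ℝ → Fin k → ℝ) (n : ℕ) (ω : ℕ × ARIndex k → ℝ) : Fin k → ℝ :=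
  arChain K (fun i => ω (0, .inl i)) (fun q => ω (q.1 + 1, q.2)) n

/-- Restarting at time `m` uses the same recursion, fed by later randomness. The shift is `m + 1`
because the step out of time `m` reads the coordinates of time `m + 1`. -/
theorem arState_add (K : ℝ × ℝ → Fin k → ℝ) (n m : ℕ) (ω : ℕ × ARIndex k → ℝ) :
    arState K (n + m) ω = arChain K (arState K m ω) (fun q => ω (q.1 + (m + 1), q.2)) n := by
  induction n with
  | zero => rw [zero_add]; rfl
  | succ n ih =>
    rw [arChain, ← ih, Nat.add_right_comm]
    rfl

/-- The σ-algebra generated by the coordinates in `S`. -/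
abbrev coordAlgebra (S : Set (ℕ × ARIndex k)) : MeasurableSpace (ℕ × ARIndex k → ℝ) :=
  ⨆ q ∈ S, MeasurableSpace.comap (fun ω => ω q) inferInstance

theorem disjoint_le_eq_succ (n : ℕ) :
    Disjoint {q : ℕ × ARIndex k | q.1 ≤ n} {q : ℕ × ARIndex k | q.1 = n + 1} :=
  Set.disjoint_left.2 fun q (h1 : q.1 ≤ n) (h2 : q.1 = n + 1) => by omega

theorem measurable_coord {S : Set (ℕ × ARIndex k)} {q : ℕ × ARIndex k} (hq : q ∈ S) :
    Measurable[coordAlgebra S] fun ω : ℕ × ARIndex k → ℝ => ω q :=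
  Measurable.of_comap_le (le_iSup₂_of_le q hq le_rfl)

/-- The recursion reads nothing later than time `n`. A general `S` also covers index sets that omit
a single later coordinate. -/
theorem measurable_arState_coord {K : ℝ × ℝ → Fin k → ℝ} (hK : Measurable K) {n : ℕ}
    {S : Set (ℕ × ARIndex k)} (hS : ∀ q : ℕ × ARIndex k, q.1 ≤ n → q ∈ S) :
    Measurable[coordAlgebra S] (arState K n) := by
  induction n with
  | zero => exact @measurable_pi_lambda _ _ _ (coordAlgebra S) _ _ fun i => measurable_coord (hS _ le_rfl)
  | succ n ih =>
    exact (measurable_arStep hK).comp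
      ((ih fun q hq => hS q (hq.trans n.le_succ)).prodMk
        (@measurable_pi_lambda _ _ _ (coordAlgebra S) _ _ fun j => measurable_coord (hS _ le_rfl)))

theorem measurable_arState {K : ℝ × ℝ → Fin k → ℝ} (hK : Measurable K) (n : ℕ) :
    Measurable (arState K n) :=
  (measurable_arChain hK n).comp (f := fun ω : ℕ × ARIndex k → ℝ =>
    ((fun i => ω (0, Sum.inl i)), fun q : ℕ × ARIndex k => ω (q.1 + 1, q.2))) (by fun_prop)

/-- The laws of the coordinates. -/
noncomputable def arLaw (k : ℕ) (μ ν β υ : Measure ℝ) : ARIndex k → Measure ℝ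
  | .inl _ => μ
  | .inr (.inl _) => ν
  | .inr (.inr true) => β
  | .inr (.inr false) => υ

instance {μ ν β υ : Measure ℝ} [IsProbabilityMeasure μ] [IsProbabilityMeasure ν]
    [IsProbabilityMeasure β] [IsProbabilityMeasure υ] (j : ARIndex k) :
    IsProbabilityMeasure (arLaw k μ ν β υ j) := by
  rcases j with _ | _ | _ | _ <;> simp only [arLaw] <;> infer_instance

/-- The law of the whole randomness. -/
noncomputable def arMeasure (k : ℕ) (μ ν β υ : Measure ℝ) [IsProbabilityMeasure μ]
    [IsProbabilityMeasure ν] [IsProbabilityMeasure β] [IsProbabilityMeasure υ] :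
    Measure (ℕ × ARIndex k → ℝ) :=
  Measure.infinitePi fun q => arLaw k μ ν β υ q.2

variable {μ ν β υ : Measure ℝ} [IsProbabilityMeasure μ]
    [IsProbabilityMeasure ν] [IsProbabilityMeasure β] [IsProbabilityMeasure υ]

instance : IsProbabilityMeasure (arMeasure k μ ν β υ) := by
  unfold arMeasure; infer_instance

theorem iIndepFun_coord :
    iIndepFun (fun (q : ℕ × ARIndex k) (ω : ℕ × ARIndex k → ℝ) => ω q) (arMeasure k μ ν β υ) :=
  iIndepFun_infinitePi (X := fun _ x => x) fun _ => measurable_id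

theorem arMeasure_map_coord (q : ℕ × ARIndex k) :
    (arMeasure k μ ν β υ).map (fun ω => ω q) = arLaw k μ ν β υ q.2 :=
  Measure.infinitePi_map_eval _ q

/-- Reduces independence in the construction to disjointness of the sets of coordinates that are
read. -/
theorem indepFun_coordAlgebra {α γ : Type*} [MeasurableSpace α] [MeasurableSpace γ]
    {S T : Set (ℕ × ARIndex k)} (hST : Disjoint S T) {f : (ℕ × ARIndex k → ℝ) → α}
    {g : (ℕ × ARIndex k → ℝ) → γ} (hf : Measurable[coordAlgebra S] f)
    (hg : Measurable[coordAlgebra T] g) : IndepFun f g (arMeasure k μ ν β υ) :=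
  iIndepFun_coord.indepFun_of_measurable_iSup_comap (fun _ => by fun_prop) hST hf hg

/-- The law of a coordinate does not depend on time, and the time shift is injective on indices. -/
theorem arMeasure_map_shift (d : ℕ) :
    (arMeasure k μ ν β υ).map (fun ω q => ω (q.1 + d, q.2)) = arMeasure k μ ν β υ :=
  Measure.map_infinitePi_infinitePi_of_inj (P := fun q : ℕ × ARIndex k => arLaw k μ ν β υ q.2)
    (f := fun q : ℕ × ARIndex k => (q.1 + d, q.2)) fun a b h => by
      simpa [Prod.ext_iff] using h

theorem arMeasure_isOne (n : ℕ) :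
    arMeasure k μ ν β υ {ω | isOne (ω (n, .inr (.inr true))) = true} = β {1} := by
  have h : (arMeasure k μ ν β υ).map (fun ω => ω (n, .inr (.inr true))) = β :=
    arMeasure_map_coord _
  have h1 := congrArg (fun ρ => ρ {1}) h
  rw [Measure.map_apply (measurable_pi_apply _) (measurableSet_singleton 1)] at h1
  rw [← h1]
  congr 1
  ext ω
  simp [isOne]

theorem arMeasure_map_arState_zero (K : ℝ × ℝ → Fin k → ℝ) :
    (arMeasure k μ ν β υ).map (arState K 0) = Measure.pi fun _ => μ := by
  have h := Measure.map_infinitePi_infinitePi_of_inj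
    (P := fun q : ℕ × ARIndex k => arLaw k μ ν β υ q.2)
    (f := fun i : Fin k => ((0 : ℕ), (Sum.inl i : ARIndex k))) fun a b h => by
      simpa using h
  exact h.trans (Measure.infinitePi_eq_pi _)

/-- The next sum does not depend on the auxiliary uniform variable of time `n + 1`. -/
theorem measurable_arState_sum_coord {K : ℝ × ℝ → Fin k → ℝ} (hK : Measurable K) (n : ℕ)
    {S : Set (ℕ × ARIndex k)} (hS : ∀ q : ℕ × ARIndex k, q.1 ≤ n → q ∈ S)
    (hb : (n + 1, Sum.inr (Sum.inr true)) ∈ S) (he : ∀ i, (n + 1, Sum.inr (Sum.inl i)) ∈ S) :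
    Measurable[coordAlgebra S] fun ω : ℕ × ARIndex k → ℝ =>
      arSum (arState K n ω) (ω (n + 1, .inr (.inr true))) fun i => ω (n + 1, .inr (.inl i)) :=
  measurable_arSum.comp ((measurable_arState_coord hK hS).prodMk ((measurable_coord hb).prodMk
    (@measurable_pi_lambda _ _ _ (coordAlgebra S) _ _ fun i => measurable_coord (he i))))

theorem measurable_arState_sum {K : ℝ × ℝ → Fin k → ℝ} (hK : Measurable K) (n : ℕ) :
    Measurable fun ω : ℕ × ARIndex k → ℝ =>
      arSum (arState K n ω) (ω (n + 1, .inr (.inr true))) fun i => ω (n + 1, .inr (.inl i)) :=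
  measurable_arSum.comp (f := fun ω : ℕ × ARIndex k → ℝ => (arState K n ω,
    ω (n + 1, Sum.inr (Sum.inr true)), fun i => ω (n + 1, Sum.inr (Sum.inl i))))
    ((measurable_arState hK n).prodMk (by fun_prop))

/-! ### Invariance of the product law, the equation, and stationarity -/

/-- The sum of the states keeps its law under one step. -/
theorem map_arSum_arState {K : ℝ × ℝ → Fin k → ℝ} (hK : Measurable K) {p : ℝ} (hp : 0 ≤ p)
    (hβ : β {1} = ENNReal.ofReal p)
    (hfix : ∀ t, charFun μ t ^ k = charFun ν t ^ k * (p + (1 - p) * charFun μ t ^ k)) {n : ℕ}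
    (hn : (arMeasure k μ ν β υ).map (arState K n) = Measure.pi fun _ => μ) :
    (arMeasure k μ ν β υ).map (fun ω =>
      arSum (arState K n ω) (ω (n + 1, .inr (.inr true))) fun i => ω (n + 1, .inr (.inl i))) =
      (Measure.pi fun _ : Fin k => μ).map fun y => ∑ i, y i := by
  set P := arMeasure k μ ν β υ with hP
  have hsum : Measurable fun x : Fin k → ℝ => ∑ i, x i := by fun_prop
  have : IsProbabilityMeasure (P.map fun ω => arSum (arState K n ω)
      (ω (n + 1, .inr (.inr true))) fun i => ω (n + 1, .inr (.inl i))) :=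
    Measure.isProbabilityMeasure_map (measurable_arState_sum hK n).aemeasurable
  refine Measure.ext_of_charFun (funext fun t => ?_)
  have hX : charFun (P.map fun ω => ∑ i, arState K n ω i) t = charFun μ t ^ k := by
    rw [← charFun_map_sum_pi_const μ t, ← hn,
      Measure.map_map hsum (measurable_arState hK n)]
    rfl
  have hZ : charFun (P.map fun ω => ∑ i, ω (n + 1, Sum.inr (Sum.inl i))) t = charFun ν t ^ k :=
    charFun_map_sum_eq_pow
      (X := fun i (ω : ℕ × ARIndex k → ℝ) => ω (n + 1, Sum.inr (Sum.inl i)))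
      (fun i => measurable_pi_apply _)
      (iIndepFun_coord.precomp
        (g := fun i : Fin k => (n + 1, (Sum.inr (Sum.inl i) : ARIndex k)))
        fun i j h => by simpa using h)
      (fun i => arMeasure_map_coord _) t
  have hZm : ∀ S : Set (ℕ × ARIndex k), (∀ i, (n + 1, Sum.inr (Sum.inl i)) ∈ S) →
      Measurable[coordAlgebra S] fun ω : ℕ × ARIndex k → ℝ =>
        ∑ i, ω (n + 1, Sum.inr (Sum.inl i)) := fun S hS =>
    hsum.comp (@measurable_pi_lambda _ _ _ (coordAlgebra S) _ _ fun i => measurable_coord (hS i))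
  have hBm : ∀ S : Set (ℕ × ARIndex k), (n + 1, Sum.inr (Sum.inr true)) ∈ S →
      Measurable[coordAlgebra S] fun ω : ℕ × ARIndex k → ℝ =>
        isOne (ω (n + 1, .inr (.inr true))) := fun S hS =>
    measurable_isOne.comp (measurable_coord hS)
  have hXBZ : IndepFun (fun ω => ∑ i, arState K n ω i)
      (fun ω => (isOne (ω (n + 1, .inr (.inr true))),
        ∑ i, ω (n + 1, Sum.inr (Sum.inl i)))) P :=
    indepFun_coordAlgebra (disjoint_le_eq_succ n)
      (hsum.comp (measurable_arState_coord hK fun q hq => hq))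
      ((hBm _ (by simp)).prodMk (hZm _ (by simp)))
  have hBZ : IndepFun (fun ω => isOne (ω (n + 1, .inr (.inr true))))
      (fun ω => ∑ i, ω (n + 1, Sum.inr (Sum.inl i))) P :=
    indepFun_coordAlgebra (S := {q | q = (n + 1, .inr (.inr true))})
      (T := {q | q ≠ (n + 1, .inr (.inr true))})
      (Set.disjoint_left.2 fun q h1 h2 => h2 h1) (hBm _ (by simp)) (hZm _ (by simp))
  have hXm : Measurable fun ω => ∑ i, arState K n ω i := hsum.comp (measurable_arState hK n)
  have hBm' : Measurable fun ω : ℕ × ARIndex k → ℝ => isOne (ω (n + 1, .inr (.inr true))) :=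
    measurable_isOne.comp (measurable_pi_apply _)
  have key := charFun_map_ite_add (P := P) hXm (by fun_prop) hBm' hXBZ hBZ
    hp ((arMeasure_isOne _).trans hβ) t
  -- The step turns f^k into ψ^k (p + (1 - p) f^k), which `hfix` identifies with f^k.
  rw [hX, hZ, ← hfix] at key
  rw [charFun_map_sum_pi_const]
  exact key

/-- The joint law of the sum produced by the autoregressive equation and of the regenerated
state. -/
theorem map_arSum_arState_succ {K : ℝ × ℝ → Fin k → ℝ} (hK : Measurable K) {p : ℝ} (hp : 0 ≤ p)
    (hβ : β {1} = ENNReal.ofReal p)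
    (hfix : ∀ t, charFun μ t ^ k = charFun ν t ^ k * (p + (1 - p) * charFun μ t ^ k))
    (hKlaw : (((Measure.pi fun _ : Fin k => μ).map fun y => ∑ i, y i).prod υ).map
      (fun q => (q.1, K q)) = (Measure.pi fun _ : Fin k => μ).map fun y => (∑ i, y i, y)) {n : ℕ}
    (hn : (arMeasure k μ ν β υ).map (arState K n) = Measure.pi fun _ => μ) :
    (arMeasure k μ ν β υ).map (fun ω =>
      (arSum (arState K n ω) (ω (n + 1, .inr (.inr true))) fun i => ω (n + 1, .inr (.inl i)),
        arState K (n + 1) ω)) =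
      (Measure.pi fun _ : Fin k => μ).map fun y => (∑ i, y i, y) := by
  have hS := measurable_arState_sum hK n
  have hind : IndepFun (fun ω : ℕ × ARIndex k → ℝ => arSum (arState K n ω)
      (ω (n + 1, .inr (.inr true))) fun i => ω (n + 1, .inr (.inl i)))
      (fun ω => ω (n + 1, .inr (.inr false))) (arMeasure k μ ν β υ) :=
    indepFun_coordAlgebra (S := {q | q ≠ (n + 1, .inr (.inr false))})
      (T := {q | q = (n + 1, .inr (.inr false))})
      (Set.disjoint_left.2 fun q h1 h2 => h1 h2)
      (measurable_arState_sum_coord hK n (fun q hq h => by simp [h] at hq) (by simp) (by simp))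
      (measurable_coord rfl)
  have h := (indepFun_iff_map_prod_eq_prod_map_map hS.aemeasurable
    (measurable_pi_apply _).aemeasurable).1 hind
  rw [map_arSum_arState hK hp hβ hfix hn, arMeasure_map_coord] at h
  -- The new state is `K` of the sum and the fresh auxiliary variable, whose joint law `h` is
  -- exactly the product in `hKlaw`.
  refine Eq.trans ?_ ((congrArg (Measure.map fun q => (q.1, K q)) h).trans hKlaw)
  rw [Measure.map_map (measurable_fst.prodMk hK) (hS.prodMk (measurable_pi_apply _))]
  rfl

/-- Induction on time: the second marginal of the joint law of sum and regenerated state is the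
product law again. -/
theorem map_arState {K : ℝ × ℝ → Fin k → ℝ} (hK : Measurable K) {p : ℝ} (hp : 0 ≤ p)
    (hβ : β {1} = ENNReal.ofReal p)
    (hfix : ∀ t, charFun μ t ^ k = charFun ν t ^ k * (p + (1 - p) * charFun μ t ^ k))
    (hKlaw : (((Measure.pi fun _ : Fin k => μ).map fun y => ∑ i, y i).prod υ).map
      (fun q => (q.1, K q)) = (Measure.pi fun _ : Fin k => μ).map fun y => (∑ i, y i, y)) (n : ℕ) :
    (arMeasure k μ ν β υ).map (arState K n) = Measure.pi fun _ => μ := by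
  induction n with
  | zero => exact arMeasure_map_arState_zero K
  | succ n ih =>
    have h := congrArg (Measure.map Prod.snd) (map_arSum_arState_succ hK hp hβ hfix hKlaw ih)
    rw [Measure.map_map measurable_snd
      ((measurable_arState_sum hK n).prodMk (measurable_arState hK (n + 1))),
      Measure.map_map measurable_snd (by fun_prop)] at h
    exact h.trans Measure.map_id

/-- The autoregressive equation. -/
theorem ae_sum_arState_succ {K : ℝ × ℝ → Fin k → ℝ} (hK : Measurable K) {p : ℝ} (hp : 0 ≤ p)
    (hβ : β {1} = ENNReal.ofReal p)
    (hfix : ∀ t, charFun μ t ^ k = charFun ν t ^ k * (p + (1 - p) * charFun μ t ^ k))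
    (hKlaw : (((Measure.pi fun _ : Fin k => μ).map fun y => ∑ i, y i).prod υ).map
      (fun q => (q.1, K q)) = (Measure.pi fun _ : Fin k => μ).map fun y => (∑ i, y i, y)) (n : ℕ) :
    ∀ᵐ ω ∂(arMeasure k μ ν β υ), ∑ i, arState K (n + 1) ω i =
      arSum (arState K n ω) (ω (n + 1, .inr (.inr true))) fun i => ω (n + 1, .inr (.inl i)) := by
  have h := map_arSum_arState_succ hK hp hβ hfix hKlaw (map_arState hK hp hβ hfix hKlaw n)
  -- The equation depends only on the joint law of the prescribed sum and the new state, and for the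
  -- pair (∑ y, y) it is an identity.
  have hset : MeasurableSet {q : ℝ × (Fin k → ℝ) | ∑ i, q.2 i = q.1} :=
    measurableSet_eq_fun (by fun_prop) (by fun_prop)
  refine (ae_map_iff ((measurable_arState_sum hK n).prodMk
    (measurable_arState hK (n + 1))).aemeasurable hset).1 ?_
  rw [h, ae_map_iff (by fun_prop) hset]
  exact ae_of_all _ fun y => rfl

/-- The chain is stationary as soon as its one-dimensional laws agree. -/
theorem isStationarySeq_arState {K : ℝ × ℝ → Fin k → ℝ} (hK : Measurable K) {π : Measure (Fin k → ℝ)}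
    (hπ : ∀ n, (arMeasure k μ ν β υ).map (arState K n) = π) :
    IsStationarySeq (arMeasure k μ ν β υ) fun n i ω => arState K n ω i := by
  intro m
  have hind : ∀ m, IndepFun (arState K m) (fun (ω : ℕ × ARIndex k → ℝ) (q : ℕ × ARIndex k) =>
      ω (q.1 + (m + 1), q.2)) (arMeasure k μ ν β υ) := fun m =>
    indepFun_coordAlgebra (S := {q | q.1 ≤ m}) (T := {q | m < q.1})
      (Set.disjoint_left.2 fun q (h1 : q.1 ≤ m) (h2 : m < q.1) => by omega)
      (measurable_arState_coord hK fun q hq => hq)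
      (@measurable_pi_lambda _ _ _ (coordAlgebra _) _ _ fun q =>
        measurable_coord (show m < q.1 + (m + 1) by omega))
  have h1 : IdentDistrib (arState K m) (arState K 0) (arMeasure k μ ν β υ)
      (arMeasure k μ ν β υ) :=
    ⟨(measurable_arState hK m).aemeasurable, (measurable_arState hK 0).aemeasurable, by
      rw [hπ, hπ]⟩
  have h2 : IdentDistrib (fun (ω : ℕ × ARIndex k → ℝ) (q : ℕ × ARIndex k) =>
      ω (q.1 + (m + 1), q.2)) (fun (ω : ℕ × ARIndex k → ℝ) (q : ℕ × ARIndex k) =>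
      ω (q.1 + (0 + 1), q.2)) (arMeasure k μ ν β υ) (arMeasure k μ ν β υ) :=
    ⟨(measurable_pi_lambda _ fun q => measurable_pi_apply _).aemeasurable,
      (measurable_pi_lambda _ fun q => measurable_pi_apply _).aemeasurable, by
        rw [arMeasure_map_shift, arMeasure_map_shift]⟩
  -- The trajectory from time `m` is one fixed measurable function of the state at `m` and the
  -- independent later randomness, a pair whose law is the same for every `m`.
  have h3 := (h1.prodMk h2 (hind m) (hind 0)).comp
    (u := fun q : (Fin k → ℝ) × (ℕ × ARIndex k → ℝ) => fun n i => arChain K q.1 q.2 n i)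
    (measurable_pi_lambda _ fun n => measurable_arChain hK n)
  convert h3 using 1
  · funext ω n i
    exact congrFun (arState_add K n m ω) i
  · funext ω n i
    exact congrFun (arState_add K n 0 ω) i

theorem isGenAR1_arState {K : ℝ × ℝ → Fin k → ℝ} (hK : Measurable K) {p : ℝ} (hp : 0 ≤ p)
    (hβ : β {1} = ENNReal.ofReal p)
    (hfix : ∀ t, charFun μ t ^ k = charFun ν t ^ k * (p + (1 - p) * charFun μ t ^ k))
    (hKlaw : (((Measure.pi fun _ : Fin k => μ).map fun y => ∑ i, y i).prod υ).map
      (fun q => (q.1, K q)) = (Measure.pi fun _ : Fin k => μ).map fun y => (∑ i, y i, y)) :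
    IsGenAR1 k p (arMeasure k μ ν β υ) (fun n i ω => arState K n ω i)
      (fun n i ω => ω (n, .inr (.inl i))) (fun n ω => isOne (ω (n, .inr (.inr true)))) ∧
    ∀ n i, HasLaw (fun ω => arState K n ω i) μ (arMeasure k μ ν β υ) := by
  have hπ := map_arState hK hp hβ hfix hKlaw
  have hm := measurable_arState hK
  have hmi : ∀ n i, Measurable fun ω => arState K n ω i := fun n i =>
    (measurable_pi_apply i).comp (hm n)
  have hlaw : ∀ n i, HasLaw (fun ω => arState K n ω i) μ (arMeasure k μ ν β υ) := fun n i =>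
    ⟨(hmi n i).aemeasurable, by
      rw [show (fun ω => arState K n ω i) = Function.eval i ∘ arState K n from rfl,
        ← Measure.map_map (measurable_pi_apply i) (hm n), hπ,
        (measurePreserving_eval (fun _ : Fin k => μ) i).map_eq]⟩
  refine ⟨{
    measurable_Y := hmi
    measurable_e := fun n i => by fun_prop
    measurable_B := fun n => measurable_isOne.comp (by fun_prop)
    indep_Y := fun n => ?_
    ident_Y := fun n i j => (hlaw n i).identDistrib (hlaw n j)
    indep_e := iIndepFun_coord.precomp
      (g := fun q : ℕ × Fin k => (q.1, (Sum.inr (Sum.inl q.2) : ARIndex k)))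
      fun a b h => by simpa [Prod.ext_iff] using h
    ident_e := fun n m i j => ⟨(measurable_pi_apply _).aemeasurable,
      (measurable_pi_apply _).aemeasurable, by
        rw [arMeasure_map_coord, arMeasure_map_coord]; rfl⟩
    indep_B := (iIndepFun_coord.precomp
      (g := fun n : ℕ => (n, (Sum.inr (Sum.inr true) : ARIndex k)))
      fun a b h => by simpa using h).comp (fun _ => isOne) fun _ => measurable_isOne
    prob_B := fun n => (arMeasure_isOne n).trans hβ
    indep_B_e := ?_
    indep_past := fun n => ?_
    equation := ae_sum_arState_succ hK hp hβ hfix hKlaw }, hlaw⟩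
  · rw [iIndepFun_iff_map_fun_eq_pi_map fun i => (hmi n i).aemeasurable]
    simp_rw [fun i => (hlaw n i).map_eq]
    exact hπ n
  · exact indepFun_coordAlgebra (S := {q | q.2 = .inr (.inr true)})
      (T := {q | q.2 ≠ .inr (.inr true)}) (Set.disjoint_left.2 fun q h1 h2 => h2 h1)
      (@measurable_pi_lambda _ _ _ (coordAlgebra _) _ _ fun n =>
        measurable_isOne.comp (measurable_coord rfl))
      (@measurable_pi_lambda _ _ _ (coordAlgebra _) _ _ fun q => measurable_coord (by simp))
  · have h1 : Measurable[coordAlgebra {q : ℕ × ARIndex k | q.1 ≤ n}]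
        fun ω (q : Fin (n + 1) × Fin k) => arState K q.1 ω q.2 :=
      @measurable_pi_lambda _ _ _ (coordAlgebra _) _ _ fun q => by
        have h : Measurable[coordAlgebra {q : ℕ × ARIndex k | q.1 ≤ n}] (arState K q.1) :=
          measurable_arState_coord hK fun r hr => hr.trans (Nat.lt_succ_iff.1 q.1.2)
        exact (measurable_pi_apply q.2).comp h
    have h2 : Measurable[coordAlgebra {q : ℕ × ARIndex k | q.1 = n + 1}]
        fun ω : ℕ × ARIndex k → ℝ => (isOne (ω (n + 1, .inr (.inr true))),
          fun i => ω (n + 1, .inr (.inl i))) :=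
      (measurable_isOne.comp (measurable_coord (by simp))).prodMk
        (@measurable_pi_lambda _ _ _ (coordAlgebra _) _ _ fun i => measurable_coord (by simp))
    exact indepFun_coordAlgebra (disjoint_le_eq_succ n) h1 h2

end Construction

/-! ### From Harris-ID to stationary models, and the equivalence -/

theorem hasStationaryGenAR1_of_isHarrisID {k : ℕ} (hk : 0 < k) {μ : Measure ℝ}
    [IsProbabilityMeasure μ] (h : IsHarrisID k μ) {p : ℝ} (hp0 : 0 < p) (hp1 : p < 1) :
    HasStationaryGenAR1 k p μ := by
  obtain ⟨N, hN, ν, hν, hf⟩ := h p hp0 hp1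
  have hfix : ∀ t, charFun μ t ^ k = charFun ν t ^ k * (p + (1 - p) * charFun μ t ^ k) := by
    intro t
    have hz := norm_charFun_le_one (μ := ν) t
    rw [← harrisPGF_pow_eq_iff hp0 hp1 k hk hz, hf t, hN _ hz]
  obtain ⟨υ, K, hυ, hK, hKlaw⟩ := exists_measurable_regenerate (Measure.pi fun _ : Fin k => μ)
    (g := fun y => ∑ i, y i) (by fun_prop)
  -- Bernoulli law on {0, 1}: the selectors are encoded as real coordinates and decoded by `isOne`.
  let β : Measure ℝ := ENNReal.ofReal p • Measure.dirac 1 + ENNReal.ofReal (1 - p) • Measure.dirac 0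
  have : IsProbabilityMeasure β := ⟨by
    simp only [β, Measure.add_apply, Measure.smul_apply, measure_univ, smul_eq_mul, mul_one]
    rw [← ENNReal.ofReal_add hp0.le (by linarith)]
    simp⟩
  have hβ : β {1} = ENNReal.ofReal p := by simp [β]
  have hM := isGenAR1_arState (ν := ν) (β := β) hK hp0.le hβ hfix hKlaw
  exact ⟨_, _, arMeasure k μ ν β υ, inferInstance, _, _, _, hM.1,
    isStationarySeq_arState hK (map_arState hK hp0.le hβ hfix hKlaw), hM.2⟩

theorem theorem2p3 (k : ℕ) (hk : 0 < k) (μ : Measure ℝ) [IsProbabilityMeasure μ] :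
    (∀ p : ℝ, 0 < p → p < 1 → HasStationaryGenAR1 k p μ) ↔ IsHarrisID k μ :=
  ⟨isHarrisID_of_hasStationaryGenAR1 hk,
    fun h _ hp0 hp1 => hasStationaryGenAR1_of_isHarrisID hk h hp0 hp1⟩
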